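/- Let $A_n(z)$ be Hermite's polynomials, defined by $A_{-1}=0$, $A_0=1$ and $$(2n+1)A_n(z)-2n(1+z)A_{n-1}(z)+(2n-1)zA_{n-2}(z)=0,\qquad n\ge 1,$$ let $\xi_n=n!/(3/2)_n$, and let $P_n(z)=A_n(z)/\xi_n$ be the monic Hermite elliptic Laurent biorthogonal polynomials. Put $G_n=\sum_{s=0}^n\frac1{2s+1}$. For $0<\theta<2\pi$ let $$K(e^{i\theta/2})=\int_0^1\frac{dx}{\sqrt{(1-x^2)(1-e^{i\theta}x^2)}}$$ be the complete elliptic integral of the first kind, with the principal square root. Then $P_n(1)\neq 0$ for all $n\ge0$, and the Christoffel transform of $(P_n)$ at $\mu=1$, $$\tilde P_n(z)=\frac{P_{n+1}(z)-U_nP_n(z)}{z-1},\qquad U_n=\frac{P_{n+1}(1)}{P_n(1)},\qquad n\ge 0,$$ consists of monic polynomials of degree $n$ with real coefficients which are Szegő polynomials, orthogonal on the unit circle. Precisely: 1. With $a_n=-\tilde P_{n+1}(0)$ (the reflection parameters) and $\tilde P_n^*(z)=z^n\overline{\tilde P_n}(1/z)$, where the bar conjugates the coefficients, $\tilde P_{n+1}(z)=z\tilde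 P_n(z)-a_n\tilde P_n^*(z)$ for all $n\ge0$. 2. For all $n\ge 0$, $$a_n=-\frac{1}{2(n+2)}-\frac{1}{2(n+2)G_{n+1}},\qquad\text{and}\qquad -1<a_n<0.$$ 3. The integral $K(e^{i\theta/2})$ converges and is nonzero for $0<\theta<2\pi$. The weight $$\tilde\rho(\theta)=\frac{\sin(\theta/2)}{2\,|K(e^{i\theta/2})|^2}$$ is positive on $(0,2\pi)$ and integrable over $[0,2\pi]$, and for all $n,m\ge0$ $$\int_0^{2\pi}\tilde P_n(e^{i\theta})\,\tilde P_m(e^{-i\theta})\,\tilde\rho(\theta)\,d\theta=h_n\delta_{nm},\qquad h_n=\prod_{j=0}^{n-1}(1-a_j^2).$$ -/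

import Mathlib

open Polynomial

noncomputable section

namespace HermiteElliptic

/-- Hermite's polynomials `A_n(z)`, where `z = k ^ 2`: the solution of
`(2n+1) A_n - 2n (1+z) A_{n-1} + (2n-1) z A_{n-2} = 0` for `n ≥ 1`
with `A_{-1} = 0` and `A_0 = 1`. -/
def A : ℕ → ℂ[X]
  | 0 => 1
  | 1 => C (2 / 3) * (1 + X)
  | n + 2 =>
      C (1 / (2 * (n : ℂ) + 5)) *
        (C (2 * ((n : ℂ) + 2)) * (1 + X) * A (n + 1) - C (2 * (n : ℂ) + 3) * X * A n)

/-- The leading coefficient `ξ_n = n! / (3/2)_n` of `A_n`. -/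
def xi (n : ℕ) : ℂ := (n.factorial : ℂ) / (ascPochhammer ℂ n).eval (3 / 2)

/-- The (monic) Hermite elliptic Laurent biorthogonal polynomials `P_n = A_n / ξ_n`. -/
def P (n : ℕ) : ℂ[X] := C (1 / xi n) * A n

/-- `G_n = ∑_{s=0}^n 1 / (2s+1)`. -/
def G (n : ℕ) : ℝ := ∑ s ∈ Finset.range (n + 1), 1 / (2 * (s : ℝ) + 1)

/-- The ratio `U_n = Q_{n+1}(μ) / Q_n(μ)` of the Christoffel transform. -/
def christoffelRatio (Q : ℕ → ℂ[X]) (μ : ℂ) (n : ℕ) : ℂ :=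
  (Q (n + 1)).eval μ / (Q n).eval μ

/-- The Christoffel transform `(Q_{n+1}(z) - U_n Q_n(z)) / (z - μ)` of a sequence of polynomials.
The division is exact as soon as `Q_n(μ) ≠ 0`. -/
def christoffelTransform (Q : ℕ → ℂ[X]) (μ : ℂ) (n : ℕ) : ℂ[X] :=
  (Q (n + 1) - C (christoffelRatio Q μ n) * Q n) /ₘ (X - C μ)

/-- The Christoffel transform at `μ = 1` of the Hermite elliptic polynomials. -/
def tildeP (n : ℕ) : ℂ[X] := christoffelTransform P 1 n

/-- The reversed polynomial `z ^ n * conj(Q)(1/z)` of a polynomial `Q` of degree `n`; `conj(Q)` has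
the conjugate coefficients. -/
def reversedPoly (n : ℕ) (Q : ℂ[X]) : ℂ[X] := (Q.map (starRingEnd ℂ)).reflect n

/-- The reflection parameters `a_n = -Φ_{n+1}(0)` of a sequence of monic polynomials. -/
def reflectionParam (Φ : ℕ → ℂ[X]) (n : ℕ) : ℂ := -(Φ (n + 1)).eval 0

/-- The integrand `1 / √((1 - x²)(1 - k² x²))` with the principal square root. -/
def ellipticIntegrand (k : ℂ) (x : ℝ) : ℂ :=
  1 / ((1 - (x : ℂ) ^ 2) * (1 - k ^ 2 * (x : ℂ) ^ 2)) ^ (1 / 2 : ℂ)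

/-- The complete elliptic integral of the first kind `K(k)` of complex modulus `k`. -/
def K (k : ℂ) : ℂ := ∫ x in (0 : ℝ)..1, ellipticIntegrand k x

/-- The weight `sin(θ/2) / (2 |K(e^{iθ/2})|²)`. -/
def rhoTilde (θ : ℝ) : ℝ :=
  Real.sin (θ / 2) / (2 * ‖K (Complex.exp (Complex.I * (θ / 2)))‖ ^ 2)

end HermiteElliptic

end

open HermiteElliptic

noncomputable section

namespace HermiteElliptic

open MeasureTheory Filter Topology
open scoped ComplexConjugate

/-! Algebra. Each `P n` is self-reciprocal with constant term 1, so reversing (z-1)P̃_n = P_{n+1} -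
U_n P_n gives (z-1)P̃_n^* = U_n z P_n - P_{n+1}. Eliminating between these two relations, with the
three-term recurrence at z = 1 in the form b_n = U_n(2 - U_{n+1}), yields the Szegő recurrence with
a_n = 1 - U_{n+1} (`tildeP_szego`). Since A_n(1) = G_n (`P_eval_one`), U_n and a_n are explicit.

Analysis. Let J_n(z) be the integral of sin^{2n} x / √(1 - z sin² x) over [0, π/2], so that
K(e^{iθ/2}) = J_0(e^{iθ}). On the unit circle z^{n+1} J_{n+1} and conj J_{n+1} both satisfy the
recurrence of A_n, hence A_n times their Casoratian is z^{n+1} J_{n+1} conj J_0 - J_0 conj J_{n+1}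
(`A_eval_mul_casoratian`). The Casoratian is evaluated by letting n tend to infinity
(`legendre_relation`). Dividing by |J_0|² expresses A_n ρ̃ as (1-z) times boundary values of powers
of z times J_{n+1}/J_0 and of a conjugate of such a product (`A_eval_mul_rhoTilde`). The quotients
J_n/J_0 are holomorphic on Re z < 1 and bounded by 2 there, so the mean value property evaluates all
integrals (`integral_circlePt_of_bounded`). The factor 1-z cancels against the z-1 of the
Christoffel transform, which gives orthogonality of P̃_n to lower powers. -/

/-- The coefficient `b_n` of the recurrence `P_{n+2} = (1+z) P_{n+1} - b_n z P_n`. -/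
def recCoeff (n : ℕ) : ℂ := (2 * (n : ℂ) + 3) ^ 2 / (4 * ((n : ℂ) + 1) * ((n : ℂ) + 2))

/-! ### Recurrence, reciprocity and special values of the Hermite polynomials. -/

lemma two_mul_natCast_add_ne_zero (n k : ℕ) (hk : k ≠ 0) : 2 * (n : ℂ) + (k : ℂ) ≠ 0 := by
  exact_mod_cast (by omega : 2 * n + k ≠ 0)

lemma natCast_add_ne_zero (n k : ℕ) (hk : k ≠ 0) : (n : ℂ) + (k : ℂ) ≠ 0 := by
  exact_mod_cast (by omega : n + k ≠ 0)

lemma ascPochhammer_three_halves_ne_zero (n : ℕ) :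
    (ascPochhammer ℂ n).eval (3 / 2) ≠ 0 := by
  induction n with
  | zero => simp
  | succ n ih =>
    rw [ascPochhammer_succ_eval]
    have h3 := two_mul_natCast_add_ne_zero n 3 (by norm_num)
    push_cast at h3
    refine mul_ne_zero ih fun h => h3 ?_
    linear_combination 2 * h

lemma xi_zero : xi 0 = 1 := by simp [xi]

lemma xi_succ (n : ℕ) : xi (n + 1) = xi n * (2 * ((n : ℂ) + 1) / (2 * n + 3)) := by
  have h3 := two_mul_natCast_add_ne_zero n 3 (by norm_num)
  have h := ascPochhammer_three_halves_ne_zero n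
  have h' := ascPochhammer_three_halves_ne_zero (n + 1)
  rw [ascPochhammer_succ_eval] at h'
  have h4 : (3 / 2 : ℂ) + n ≠ 0 := right_ne_zero_of_mul h'
  push_cast at h3
  unfold xi
  rw [ascPochhammer_succ_eval, Nat.factorial_succ]
  push_cast
  field_simp
  ring

lemma xi_ne_zero (n : ℕ) : xi n ≠ 0 :=
  div_ne_zero (by exact_mod_cast n.factorial_ne_zero) (ascPochhammer_three_halves_ne_zero n)

lemma A_zero : A 0 = 1 := by rw [A]

lemma A_one : A 1 = C (2 / 3) * (1 + X) := by rw [A]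

lemma A_add_two (n : ℕ) : A (n + 2) = C (1 / (2 * (n : ℂ) + 5)) *
    (C (2 * ((n : ℂ) + 2)) * (1 + X) * A (n + 1) - C (2 * (n : ℂ) + 3) * X * A n) := by
  rw [A]

lemma A_eq (n : ℕ) : A n = C (xi n) * P n := by
  rw [P, ← mul_assoc, ← C_mul, mul_one_div_cancel (xi_ne_zero n), C_1, one_mul]

lemma P_zero : P 0 = 1 := by simp [P, A_zero, xi_zero]

lemma P_one : P 1 = 1 + X := by
  rw [P, A_one, xi_succ, xi_zero, ← mul_assoc, ← C_mul]
  norm_num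

lemma P_add_two (n : ℕ) : P (n + 2) = (1 + X) * P (n + 1) - C (recCoeff n) * X * P n := by
  have h3 := two_mul_natCast_add_ne_zero n 3 (by norm_num)
  have h5 := two_mul_natCast_add_ne_zero n 5 (by norm_num)
  have h1 := natCast_add_ne_zero n 1 (by norm_num)
  have h2 := natCast_add_ne_zero n 2 (by norm_num)
  have hx := xi_ne_zero n
  push_cast at h3 h5 h1 h2
  have h5' : 2 * ((n : ℂ) + 1) + 3 ≠ 0 := by convert h5 using 1; ring
  have h2' : (n : ℂ) + 1 + 1 ≠ 0 := by convert h2 using 1; ring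
  have e1 : 1 / xi (n + 2) * (1 / (2 * (n : ℂ) + 5)) * (2 * ((n : ℂ) + 2)) * xi (n + 1) = 1 := by
    rw [xi_succ (n + 1), xi_succ n]
    push_cast
    field_simp
    ring
  have e2 : 1 / xi (n + 2) * (1 / (2 * (n : ℂ) + 5)) * (2 * (n : ℂ) + 3) * xi n
      = recCoeff n := by
    rw [xi_succ (n + 1), xi_succ n, recCoeff]
    push_cast
    field_simp
    ring
  rw [P, A_add_two, A_eq (n + 1), A_eq n, ← e2]
  have e1' := congrArg C e1
  simp only [C_mul, C_1] at e1' ⊢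
  linear_combination (1 + X) * P (n + 1) * e1'

lemma P_map_conj (n : ℕ) : (P n).map (starRingEnd ℂ) = P n := by
  have hb (n : ℕ) : starRingEnd ℂ (recCoeff n) = recCoeff n := by simp [recCoeff, map_ofNat]
  induction n using Nat.twoStepInduction with
  | zero => simp [P_zero]
  | one => simp [P_one]
  | more n h0 h1 => simp [P_add_two, h0, h1, hb]

lemma P_natDegree_le (n : ℕ) : (P n).natDegree ≤ n := by
  induction n using Nat.twoStepInduction with
  | zero => simp [P_zero]
  | one => rw [P_one]; compute_degree
  | more n h0 h1 =>
    rw [P_add_two, mul_assoc]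
    refine (natDegree_sub_le _ _).trans (max_le ?_ ?_)
    · refine natDegree_mul_le.trans ?_
      have : (1 + X : ℂ[X]).natDegree ≤ 1 := by compute_degree
      omega
    · refine (natDegree_C_mul_le _ _).trans (natDegree_mul_le.trans ?_)
      simp only [natDegree_X]
      omega

lemma P_eval_zero (n : ℕ) : (P n).eval 0 = 1 := by
  induction n using Nat.twoStepInduction with
  | zero => simp [P_zero]
  | one => simp [P_one]
  | more n h0 h1 => simp [P_add_two, h1]

lemma P_reflect (n : ℕ) : (P n).reflect n = P n := by
  have hX : reflect 1 (1 + X : ℂ[X]) = 1 + X := by simp [add_comm]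
  induction n using Nat.twoStepInduction with
  | zero => simp [P_zero]
  | one => rw [P_one, hX]
  | more n h0 h1 =>
    have e1 : reflect (n + 2) ((1 + X) * P (n + 1)) = (1 + X) * P (n + 1) := by
      rw [show n + 2 = 1 + (n + 1) by ring, reflect_mul _ _ (by compute_degree)
        (P_natDegree_le _), h1, hX]
    have e2 : reflect (n + 2) (X * P n) = X * P n := by
      rw [show n + 2 = 2 + n by ring, reflect_mul _ _ (by simp)
        (P_natDegree_le _), h0]
      congr 1
      simpa using reflect_monomial (R := ℂ) 2 1
    rw [P_add_two, mul_assoc, reflect_sub, reflect_C_mul, e1, e2]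

/-- Reciprocity exchanges the leading and the constant coefficient. -/
lemma P_coeff_self (n : ℕ) : (P n).coeff n = 1 := by
  rw [← P_eval_zero n, ← coeff_zero_eq_eval_zero]
  conv_lhs => rw [← P_reflect n]
  simp

lemma G_pos (n : ℕ) : 0 < G n :=
  Finset.sum_pos (fun _ _ => by positivity) (by simp)

lemma G_succ (n : ℕ) : G (n + 1) = G n + 1 / (2 * (n : ℝ) + 3) := by
  rw [G, Finset.sum_range_succ, ← G]
  push_cast
  ring_nf

lemma G_ne_zero (n : ℕ) : (G n : ℂ) ≠ 0 := by exact_mod_cast (G_pos n).ne'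

/-- At z = 1 Hermite's recurrence says that (2n+1)(A_n - A_{n-1}) does not depend on n; it equals 1,
so A_n(1) is the sum `G n`. -/
lemma P_eval_one (n : ℕ) : (P n).eval 1 = G n / xi n := by
  induction n using Nat.twoStepInduction with
  | zero => simp [P_zero, xi_zero, G]
  | one =>
    rw [P_one, xi_succ, xi_zero]
    simp [G, Finset.sum_range_succ]
    norm_num
  | more n h0 h1 =>
    have h3 := two_mul_natCast_add_ne_zero n 3 (by norm_num)
    have h5 := two_mul_natCast_add_ne_zero n 5 (by norm_num)
    have h1' := natCast_add_ne_zero n 1 (by norm_num)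
    have h2 := natCast_add_ne_zero n 2 (by norm_num)
    have hx := xi_ne_zero n
    push_cast at h3 h5 h1' h2
    have h5' : 2 * ((n : ℂ) + 1) + 3 ≠ 0 := by convert h5 using 1; ring
    have h2' : (n : ℂ) + 1 + 1 ≠ 0 := by convert h2 using 1; ring
    simp only [P_add_two, eval_sub, eval_mul, eval_add, eval_one, eval_X, eval_C, h0, h1]
    rw [xi_succ (n + 1), xi_succ n, recCoeff, G_succ (n + 1), G_succ n]
    push_cast
    field_simp
    ring

lemma P_eval_one_ne_zero (n : ℕ) : (P n).eval 1 ≠ 0 := by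
  rw [P_eval_one]
  exact div_ne_zero (G_ne_zero n) (xi_ne_zero n)

lemma christoffelRatio_P_ne_zero (n : ℕ) : christoffelRatio P 1 n ≠ 0 :=
  div_ne_zero (P_eval_one_ne_zero _) (P_eval_one_ne_zero _)

lemma christoffelRatio_P_succ (n : ℕ) :
    christoffelRatio P 1 (n + 1) = 2 - recCoeff n / christoffelRatio P 1 n := by
  have h0 := P_eval_one_ne_zero n
  have h1 := P_eval_one_ne_zero (n + 1)
  unfold christoffelRatio
  rw [P_add_two]
  simp only [eval_sub, eval_mul, eval_add, eval_one, eval_X, eval_C]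
  field_simp
  ring

lemma christoffelRatio_P (n : ℕ) : christoffelRatio P 1 n =
    ((1 + 1 / (2 * ((n : ℝ) + 1)) + 1 / (2 * ((n : ℝ) + 1) * G n) : ℝ) : ℂ) := by
  have h3 := two_mul_natCast_add_ne_zero n 3 (by norm_num)
  have h1 := natCast_add_ne_zero n 1 (by norm_num)
  have hx := xi_ne_zero n
  have hG := G_ne_zero n
  push_cast at h3 h1
  unfold christoffelRatio
  rw [P_eval_one, P_eval_one, xi_succ, G_succ]
  push_cast
  field_simp
  ring

/-! ### The Christoffel transform and its Szegő recurrence. -/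

lemma X_sub_one_mul_tildeP (n : ℕ) :
    (X - C 1) * tildeP n = P (n + 1) - C (christoffelRatio P 1 n) * P n := by
  rw [tildeP, christoffelTransform]
  refine mul_divByMonic_eq_iff_isRoot.2 ?_
  have := P_eval_one_ne_zero n
  simp only [IsRoot, eval_sub, eval_mul, eval_C, christoffelRatio]
  field_simp
  ring

lemma tildeP_map_conj (n : ℕ) : (tildeP n).map (starRingEnd ℂ) = tildeP n := by
  have hU : starRingEnd ℂ (christoffelRatio P 1 n) = christoffelRatio P 1 n := by
    rw [christoffelRatio_P, Complex.conj_ofReal]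
  have h : (X - C (1 : ℂ)) * (tildeP n).map (starRingEnd ℂ) = (X - C 1) * tildeP n :=
    calc (X - C (1 : ℂ)) * (tildeP n).map (starRingEnd ℂ)
        = ((X - C (1 : ℂ)) * tildeP n).map (starRingEnd ℂ) := by
          rw [Polynomial.map_mul, Polynomial.map_sub, map_X, map_C, map_one (starRingEnd ℂ)]
      _ = (X - C 1) * tildeP n := by
          rw [X_sub_one_mul_tildeP, Polynomial.map_sub, Polynomial.map_mul, map_C, hU, P_map_conj,
            P_map_conj]
  exact mul_left_cancel₀ (X_sub_C_ne_zero (1 : ℂ)) h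

lemma monic_X_sub_one_mul_tildeP (n : ℕ) : ((X - C 1) * tildeP n).Monic := by
  rw [X_sub_one_mul_tildeP]
  refine monic_of_natDegree_le_of_coeff_eq_one (n + 1) ?_ ?_
  · refine (natDegree_sub_le _ _).trans (max_le (P_natDegree_le _) ?_)
    exact (natDegree_C_mul_le _ _).trans ((P_natDegree_le n).trans n.le_succ)
  · rw [coeff_sub, coeff_C_mul, P_coeff_self,
      coeff_eq_zero_of_natDegree_lt (Nat.lt_succ_of_le (P_natDegree_le n))]
    simp

lemma tildeP_monic (n : ℕ) : (tildeP n).Monic :=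
  (monic_X_sub_C 1).of_mul_monic_left (monic_X_sub_one_mul_tildeP n)

lemma tildeP_natDegree (n : ℕ) : (tildeP n).natDegree = n := by
  have h1 : ((X - C 1) * tildeP n).natDegree = n + 1 := by
    refine le_antisymm ?_ ?_
    · rw [X_sub_one_mul_tildeP]
      refine (natDegree_sub_le _ _).trans (max_le (P_natDegree_le _) ?_)
      exact (natDegree_C_mul_le _ _).trans ((P_natDegree_le n).trans n.le_succ)
    · refine le_natDegree_of_ne_zero ?_
      rw [X_sub_one_mul_tildeP, coeff_sub, coeff_C_mul, P_coeff_self,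
        coeff_eq_zero_of_natDegree_lt (Nat.lt_succ_of_le (P_natDegree_le n))]
      simp
  rw [(monic_X_sub_C 1).natDegree_mul (tildeP_monic n), natDegree_X_sub_C] at h1
  omega

lemma X_sub_one_mul_reversedPoly_tildeP (n : ℕ) :
    (X - C 1) * reversedPoly n (tildeP n) = C (christoffelRatio P 1 n) * X * P n - P (n + 1) := by
  have h := congrArg (reflect (1 + n)) (X_sub_one_mul_tildeP n)
  rw [reflect_mul _ _ (natDegree_X_sub_C_le 1) (tildeP_natDegree n).le, reflect_sub, reflect_sub,
    reflect_C_mul, reflect_C, add_comm 1 n, P_reflect, add_comm n 1] at h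
  -- Reversal in degree n + 1, one more than the degree of `P n`, produces the extra factor X.
  have e : reflect (1 + n) (P n) = X * P n := by
    conv_lhs => rw [← one_mul (P n), reflect_mul _ _ (by simp) (P_natDegree_le n), P_reflect]
    simp
  rw [e, reflect_one_X, add_comm 1 n] at h
  rw [reversedPoly, tildeP_map_conj]
  simp only [C_1] at h ⊢
  linear_combination -h

lemma reflectionParam_tildeP (n : ℕ) :
    reflectionParam tildeP n = 1 - christoffelRatio P 1 (n + 1) := by
  have h := congrArg (eval 0) (X_sub_one_mul_tildeP (n + 1))
  simp only [eval_mul, eval_sub, eval_X, eval_C, P_eval_zero] at h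
  rw [reflectionParam]
  linear_combination h

lemma tildeP_szego (n : ℕ) : tildeP (n + 1) =
    X * tildeP n - C (reflectionParam tildeP n) * reversedPoly n (tildeP n) := by
  refine mul_left_cancel₀ (X_sub_C_ne_zero (1 : ℂ)) ?_
  have h0 := X_sub_one_mul_tildeP n
  have h1 := X_sub_one_mul_tildeP (n + 1)
  have h2 := X_sub_one_mul_reversedPoly_tildeP n
  have hU := christoffelRatio_P_ne_zero n
  -- Expressing b_n through U_n and U_{n+1} lets P_n and P_{n+1} be eliminated linearly.
  have e : recCoeff n = christoffelRatio P 1 n * (2 - christoffelRatio P 1 (n + 1)) := by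
    rw [christoffelRatio_P_succ]
    field_simp
    ring
  rw [reflectionParam_tildeP, h1, P_add_two, e]
  simp only [C_mul, C_sub, C_1, C_ofNat] at *
  linear_combination -X * h0 + (1 - C (christoffelRatio P 1 (n + 1))) * h2

lemma one_sub_reflectionParam_sq (n : ℕ) : 1 - reflectionParam tildeP n ^ 2 =
    christoffelRatio P 1 (n + 1) * recCoeff n / christoffelRatio P 1 n := by
  have hU := christoffelRatio_P_ne_zero n
  rw [reflectionParam_tildeP, christoffelRatio_P_succ]
  field_simp
  ring

lemma reflectionParam_tildeP_eq_ofReal (n : ℕ) : reflectionParam tildeP n =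
    ((-1 / (2 * ((n : ℝ) + 2)) - 1 / (2 * ((n : ℝ) + 2) * G (n + 1)) : ℝ) : ℂ) := by
  rw [reflectionParam_tildeP, christoffelRatio_P]
  push_cast
  ring_nf

lemma one_lt_G_succ (n : ℕ) : 1 < G (n + 1) := by
  induction n with
  | zero => simp [G, Finset.sum_range_succ]; norm_num
  | succ n ih =>
    rw [G_succ]
    have : (0 : ℝ) < 1 / (2 * ((n + 1 : ℕ) : ℝ) + 3) := by positivity
    linarith

lemma reflectionParam_tildeP_mem (n : ℕ) :
    -1 < (reflectionParam tildeP n).re ∧ (reflectionParam tildeP n).re < 0 := by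
  rw [reflectionParam_tildeP_eq_ofReal, Complex.ofReal_re]
  have hG := one_lt_G_succ n
  have hn : (0 : ℝ) ≤ n := n.cast_nonneg
  -- As n + 2 ≥ 2 and G_{n+1} > 1, each term is at most 1/4, so a_n ≥ -1/2.
  have h1 : 1 / (2 * ((n : ℝ) + 2)) ≤ 1 / 4 := by
    apply one_div_le_one_div_of_le <;> linarith
  have h2 : 1 / (2 * ((n : ℝ) + 2) * G (n + 1)) ≤ 1 / 4 := by
    apply one_div_le_one_div_of_le <;> nlinarith
  have h3 : 0 < 1 / (2 * ((n : ℝ) + 2)) := by positivity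
  have h4 : 0 < 1 / (2 * ((n : ℝ) + 2) * G (n + 1)) := by
    have := G_pos (n + 1)
    positivity
  rw [neg_div]
  constructor <;> linarith

lemma tildeP_coeff_im (n j : ℕ) : ((tildeP n).coeff j).im = 0 := by
  have h := congrArg (fun q => coeff q j) (tildeP_map_conj n)
  simp only [coeff_map] at h
  exact Complex.conj_eq_iff_im.1 h

/-! ### Elliptic moments on the half plane Re z < 1: holomorphy, recurrence and bounds. -/

lemma one_sub_mul_sin_sq_re_pos {z : ℂ} (hz : z.re < 1) (x : ℝ) :
    0 < (1 - z * (Real.sin x : ℂ) ^ 2).re := by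
  have h : (1 - z * (Real.sin x : ℂ) ^ 2).re = 1 - z.re * Real.sin x ^ 2 := by
    rw [← Complex.ofReal_pow, Complex.sub_re, Complex.re_mul_ofReal, Complex.one_re]
  rw [h]
  have h1 := Real.sin_sq_le_one x
  rcases le_or_gt z.re 0 with h0 | h0 <;> nlinarith [sq_nonneg (Real.sin x)]

lemma one_sub_mul_sin_sq_mem_slitPlane {z : ℂ} (hz : z.re < 1) (x : ℝ) :
    1 - z * (Real.sin x : ℂ) ^ 2 ∈ Complex.slitPlane :=
  Or.inl (one_sub_mul_sin_sq_re_pos hz x)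

/-- The moment integrand `sin^{2n} x / √(1 - z sin² x)`. -/
def momentIntegrand (n : ℕ) (z : ℂ) (x : ℝ) : ℂ :=
  (Real.sin x : ℂ) ^ (2 * n) * (1 - z * (Real.sin x : ℂ) ^ 2) ^ (-(1 / 2) : ℂ)

/-- The elliptic moments `∫_0^{π/2} sin^{2n} x / √(1 - z sin² x) dx`. -/
def ellipticMoment (n : ℕ) (z : ℂ) : ℂ := ∫ x in (0 : ℝ)..(Real.pi / 2), momentIntegrand n z x

lemma continuous_momentIntegrand (n : ℕ) {z : ℂ} (hz : z.re < 1) :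
    Continuous (momentIntegrand n z) := by
  unfold momentIntegrand
  refine (by fun_prop : Continuous fun x : ℝ => (Real.sin x : ℂ) ^ (2 * n)).mul ?_
  exact (by fun_prop : Continuous fun x : ℝ => 1 - z * (Real.sin x : ℂ) ^ 2).cpow
    continuous_const fun x => one_sub_mul_sin_sq_mem_slitPlane hz x

lemma isOpen_re_lt_one : IsOpen {z : ℂ | z.re < 1} :=
  isOpen_lt Complex.continuous_re continuous_const

lemma differentiableOn_ellipticMoment (n : ℕ) :
    DifferentiableOn ℂ (ellipticMoment n) {z : ℂ | z.re < 1} := by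
  intro z₀ hz₀
  refine DifferentiableAt.differentiableWithinAt ?_
  obtain ⟨ε, hε, hball⟩ := Metric.nhds_basis_closedBall.mem_iff.1 (isOpen_re_lt_one.mem_nhds hz₀)
  let F' : ℂ → ℝ → ℂ := fun z x => (Real.sin x : ℂ) ^ (2 * n) *
    (-(1 / 2) * (1 - z * (Real.sin x : ℂ) ^ 2) ^ (-(1 / 2) - 1 : ℂ) * (-(Real.sin x : ℂ) ^ 2))
  have hF' : ContinuousOn (fun p : ℂ × ℝ => F' p.1 p.2)
      (Metric.closedBall z₀ ε ×ˢ Set.Icc 0 (Real.pi / 2)) := by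
    have h1 : ContinuousOn (fun p : ℂ × ℝ =>
        (1 - p.1 * (Real.sin p.2 : ℂ) ^ 2) ^ (-(1 / 2) - 1 : ℂ))
        (Metric.closedBall z₀ ε ×ˢ Set.Icc 0 (Real.pi / 2)) :=
      ContinuousOn.cpow (Continuous.continuousOn (by fun_prop)) continuousOn_const
        fun p hp => one_sub_mul_sin_sq_mem_slitPlane (hball hp.1) p.2
    refine ContinuousOn.mul (Continuous.continuousOn (by fun_prop)) ?_
    exact (continuousOn_const.mul h1).mul (Continuous.continuousOn (by fun_prop))
  -- Compactness supplies the constant that dominates the z-derivative of the integrand near z₀.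
  obtain ⟨M, hM⟩ := ((isCompact_closedBall z₀ ε).prod isCompact_Icc).exists_bound_of_continuousOn hF'
  have hpi : (0 : ℝ) ≤ Real.pi / 2 := by positivity
  have hderiv (z : ℂ) (hz : z.re < 1) (x : ℝ) :
      HasDerivAt (fun z => momentIntegrand n z x) (F' z x) z := by
    have h1 : HasDerivAt (fun z : ℂ => 1 - z * (Real.sin x : ℂ) ^ 2) (-(Real.sin x : ℂ) ^ 2) z := by
      simpa using ((hasDerivAt_id z).mul_const ((Real.sin x : ℂ) ^ 2)).const_sub 1
    exact (h1.cpow_const (c := (-(1 / 2) : ℂ))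
      (one_sub_mul_sin_sq_mem_slitPlane hz x)).const_mul ((Real.sin x : ℂ) ^ (2 * n))
  refine (intervalIntegral.hasDerivAt_integral_of_dominated_loc_of_deriv_le (F := momentIntegrand n)
    (F' := F') (bound := fun _ => M) (Metric.closedBall_mem_nhds z₀ hε) ?_ ?_ ?_ ?_ ?_ ?_).2
    |>.differentiableAt
  · filter_upwards [isOpen_re_lt_one.mem_nhds hz₀] with z hz
    exact (continuous_momentIntegrand n hz).aestronglyMeasurable
  · exact (continuous_momentIntegrand n hz₀).intervalIntegrable _ _
  · refine ContinuousOn.aestronglyMeasurable ?_ measurableSet_uIoc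
    refine hF'.comp (f := fun x : ℝ => (z₀, x)) (Continuous.continuousOn (by fun_prop)) fun x hx => ?_
    rw [Set.uIoc_of_le hpi] at hx
    exact ⟨Metric.mem_closedBall_self hε.le, Set.Ioc_subset_Icc_self hx⟩
  · refine ae_of_all _ fun x hx z hz => ?_
    rw [Set.uIoc_of_le hpi] at hx
    exact hM (z, x) ⟨hz, Set.Ioc_subset_Icc_self hx⟩
  · exact intervalIntegrable_const
  · exact ae_of_all _ fun x _ z hz => hderiv z (hball hz) x

/-- Integrate the derivative of sin^{2n+1} x cos x √(1 - z sin² x): the boundary terms vanish, by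
the sine at 0 and the cosine at π/2. -/
lemma ellipticMoment_rec (n : ℕ) {z : ℂ} (hz : z.re < 1) :
    (2 * (n : ℂ) + 3) * z * ellipticMoment (n + 2) z =
      (2 * (n : ℂ) + 2) * (1 + z) * ellipticMoment (n + 1) z
        - (2 * (n : ℂ) + 1) * ellipticMoment n z := by
  have hint (m : ℕ) := (continuous_momentIntegrand m hz).intervalIntegrable (μ := volume)
    0 (Real.pi / 2)
  let D : ℝ → ℂ := fun x => (2 * (n : ℂ) + 3) * z * momentIntegrand (n + 2) z x -
    (2 * (n : ℂ) + 2) * (1 + z) * momentIntegrand (n + 1) z x +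
      (2 * (n : ℂ) + 1) * momentIntegrand n z x
  have hderiv (x : ℝ) : HasDerivAt (fun x : ℝ => (Real.sin x : ℂ) ^ (2 * n + 1) * (Real.cos x : ℂ) *
      (1 - z * (Real.sin x : ℂ) ^ 2) ^ (1 / 2 : ℂ)) (D x) x := by
    have hs : HasDerivAt (fun x : ℝ => (Real.sin x : ℂ)) (Real.cos x : ℂ) x :=
      (Real.hasDerivAt_sin x).ofReal_comp
    have hc : HasDerivAt (fun x : ℝ => (Real.cos x : ℂ)) (-(Real.sin x : ℂ)) x := by
      simpa using (Real.hasDerivAt_cos x).ofReal_comp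
    have hr : HasDerivAt (fun x : ℝ => 1 - z * (Real.sin x : ℂ) ^ 2)
        (-(z * (2 * (Real.sin x : ℂ) * (Real.cos x : ℂ)))) x := by
      simpa using ((hs.pow 2).const_mul z).const_sub 1
    have hmem := one_sub_mul_sin_sq_mem_slitPlane hz x
    have hne := Complex.slitPlane_ne_zero hmem
    have hq := (HasDerivAt.cpow_const (c := (1 / 2 : ℂ))
      (hasDerivAt_id (1 - z * (Real.sin x : ℂ) ^ 2)) hmem).comp x hr
    refine (((hs.pow (2 * n + 1)).mul hc).mul hq).congr_deriv ?_
    have hsq : (Real.cos x : ℂ) ^ 2 = 1 - (Real.sin x : ℂ) ^ 2 := by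
      exact_mod_cast Real.cos_sq' x
    have e1 : (1 - z * (Real.sin x : ℂ) ^ 2) ^ (1 / 2 : ℂ) = (1 - z * (Real.sin x : ℂ) ^ 2) *
        (1 - z * (Real.sin x : ℂ) ^ 2) ^ (-(1 / 2) : ℂ) := by
      conv_lhs => rw [show (1 / 2 : ℂ) = 1 + -(1 / 2) by norm_num, Complex.cpow_add _ _ hne,
        Complex.cpow_one]
    have e2 : (1 / 2 - 1 : ℂ) = -(1 / 2) := by norm_num
    simp only [D, momentIntegrand, Pi.pow_apply, Pi.mul_apply, id, Function.comp_apply]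
    rw [e2, e1]
    generalize (1 - z * (Real.sin x : ℂ) ^ 2) ^ (-(1 / 2) : ℂ) = u
    generalize (Real.sin x : ℂ) = s at *
    generalize (Real.cos x : ℂ) = c at *
    push_cast
    linear_combination (((2 * n + 1) * s ^ (2 * n) * (1 - z * s ^ 2) * u)
      - z * s ^ (2 * n + 2) * u) * hsq
  have hD : Continuous D := by
    have h0 := continuous_momentIntegrand n hz
    have h1 := continuous_momentIntegrand (n + 1) hz
    have h2 := continuous_momentIntegrand (n + 2) hz
    fun_prop
  have h := intervalIntegral.integral_eq_sub_of_hasDerivAt (fun x _ => hderiv x)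
    (hD.intervalIntegrable 0 (Real.pi / 2))
  simp only [D] at h
  rw [intervalIntegral.integral_add (((hint _).const_mul _).sub ((hint _).const_mul _))
    ((hint _).const_mul _), intervalIntegral.integral_sub ((hint _).const_mul _)
    ((hint _).const_mul _)] at h
  simp only [intervalIntegral.integral_const_mul] at h
  have h' : (2 * (n : ℂ) + 3) * z * ellipticMoment (n + 2) z -
      (2 * (n : ℂ) + 2) * (1 + z) * ellipticMoment (n + 1) z +
        (2 * (n : ℂ) + 1) * ellipticMoment n z = 0 := by
    simpa [ellipticMoment] using h
  linear_combination h'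

/-- The argument of w^{-1/2} is less than π/4 in absolute value, so its cosine exceeds 1/2. This
makes Re J_0 control every J_n, which both excludes zeros of J_0 and bounds J_n/J_0. -/
lemma norm_cpow_neg_half_le {w : ℂ} (hw : 0 < w.re) :
    ‖w ^ (-(1 / 2) : ℂ)‖ ≤ 2 * (w ^ (-(1 / 2) : ℂ)).re := by
  have hne : w ≠ 0 := by rintro rfl; simp at hw
  have harg : |w.arg| < Real.pi / 2 := Complex.abs_arg_lt_pi_div_two_iff.2 (Or.inl hw)
  rw [Complex.cpow_def_of_ne_zero hne, Complex.norm_exp, Complex.exp_re]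
  have him : (Complex.log w * (-(1 / 2) : ℂ)).im = -(w.arg / 2) := by
    rw [show (-(1 / 2) : ℂ) = ((-(1 / 2) : ℝ) : ℂ) by push_cast; ring, Complex.im_mul_ofReal,
      Complex.log_im]
    ring
  rw [him, Real.cos_neg]
  have hcos := Real.one_sub_sq_div_two_le_cos (x := w.arg / 2)
  have hpi := Real.pi_lt_four
  have h1 : (w.arg / 2) ^ 2 ≤ 1 := by
    rw [← sq_abs, abs_div, abs_two]
    have := abs_nonneg w.arg
    nlinarith
  nlinarith [Real.exp_pos (Complex.log w * (-(1 / 2) : ℂ)).re]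

lemma cpow_neg_half_re_pos {w : ℂ} (hw : 0 < w.re) : 0 < (w ^ (-(1 / 2) : ℂ)).re := by
  have hne : w ≠ 0 := by rintro rfl; simp at hw
  have h : 0 < ‖w ^ (-(1 / 2) : ℂ)‖ := norm_pos_iff.2 ((Complex.cpow_ne_zero_iff_of_exponent_ne_zero
    (by norm_num)).2 hne)
  linarith [norm_cpow_neg_half_le hw]

lemma ellipticMoment_zero_re {z : ℂ} (hz : z.re < 1) : (ellipticMoment 0 z).re =
    ∫ x in (0 : ℝ)..(Real.pi / 2), (momentIntegrand 0 z x).re := by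
  have h := (continuous_momentIntegrand 0 hz).intervalIntegrable (μ := volume) 0 (Real.pi / 2)
  exact (Complex.reCLM.intervalIntegral_comp_comm h).symm

lemma ellipticMoment_zero_re_pos {z : ℂ} (hz : z.re < 1) : 0 < (ellipticMoment 0 z).re := by
  rw [ellipticMoment_zero_re hz]
  refine intervalIntegral.intervalIntegral_pos_of_pos ?_ (fun x => ?_) (by positivity)
  · exact (Complex.continuous_re.comp (continuous_momentIntegrand 0 hz)).intervalIntegrable _ _
  · simpa [momentIntegrand] using cpow_neg_half_re_pos (one_sub_mul_sin_sq_re_pos hz x)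

lemma ellipticMoment_zero_ne_zero {z : ℂ} (hz : z.re < 1) : ellipticMoment 0 z ≠ 0 := by
  intro h
  have := ellipticMoment_zero_re_pos hz
  simp [h] at this

lemma norm_ellipticMoment_le (n : ℕ) {z : ℂ} (hz : z.re < 1) :
    ‖ellipticMoment n z‖ ≤ 2 * ‖ellipticMoment 0 z‖ := by
  have hpi : (0 : ℝ) ≤ Real.pi / 2 := by positivity
  have hc := continuous_momentIntegrand n hz
  have hc0 := continuous_momentIntegrand 0 hz
  calc ‖ellipticMoment n z‖
      ≤ ∫ x in (0 : ℝ)..(Real.pi / 2), ‖momentIntegrand n z x‖ :=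
        intervalIntegral.norm_integral_le_integral_norm hpi
    _ ≤ ∫ x in (0 : ℝ)..(Real.pi / 2), 2 * (momentIntegrand 0 z x).re := by
        refine intervalIntegral.integral_mono_on hpi (hc.norm.intervalIntegrable _ _)
          ((continuous_const.mul (Complex.continuous_re.comp hc0)).intervalIntegrable _ _)
          fun x _ => ?_
        have h1 := norm_cpow_neg_half_le (one_sub_mul_sin_sq_re_pos hz x)
        have h2 : ‖(Real.sin x : ℂ) ^ (2 * n)‖ ≤ 1 := by
          rw [norm_pow, Complex.norm_real]
          exact pow_le_one₀ (norm_nonneg _) (Real.abs_sin_le_one x)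
        simp only [momentIntegrand, norm_mul, mul_zero, pow_zero, one_mul]
        exact (mul_le_of_le_one_left (norm_nonneg _) h2).trans h1
    _ = 2 * (ellipticMoment 0 z).re := by
        rw [intervalIntegral.integral_const_mul, ellipticMoment_zero_re hz]
    _ ≤ 2 * ‖ellipticMoment 0 z‖ := by
        linarith [Complex.re_le_norm (ellipticMoment 0 z)]

/-! ### The substitution x = sin t in the elliptic integral. -/

lemma sin_image_Ioo : Real.sin '' Set.Ioo 0 (Real.pi / 2) = Set.Ioo 0 1 := by
  have hpi := Real.pi_pos
  ext y
  constructor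
  · rintro ⟨x, ⟨h0, h1⟩, rfl⟩
    refine ⟨Real.sin_pos_of_pos_of_lt_pi h0 (by linarith), ?_⟩
    rw [← Real.sin_pi_div_two]
    exact Real.sin_lt_sin_of_lt_of_le_pi_div_two (by linarith) le_rfl h1
  · rintro ⟨h0, h1⟩
    exact ⟨Real.arcsin y, ⟨Real.arcsin_pos.2 h0, Real.arcsin_lt_pi_div_two.2 h1⟩,
      Real.sin_arcsin (by linarith) h1.le⟩

lemma injOn_sin_Ioo : Set.InjOn Real.sin (Set.Ioo 0 (Real.pi / 2)) :=
  Real.injOn_sin.mono fun x hx =>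
    (⟨by linarith [hx.1, Real.pi_pos], hx.2.le⟩ : x ∈ Set.Icc (-(Real.pi / 2)) (Real.pi / 2))

/-- The principal root is not multiplicative in general, but a positive factor leaves the argument
unchanged. -/
lemma ofReal_sq_mul_cpow_half {a : ℝ} (ha : 0 < a) {w : ℂ} (hw : w ≠ 0) :
    ((a : ℂ) ^ 2 * w) ^ (1 / 2 : ℂ) = a * w ^ (1 / 2 : ℂ) := by
  have ha' : (a : ℂ) ≠ 0 := by exact_mod_cast ha.ne'
  rw [Complex.cpow_def_of_ne_zero (mul_ne_zero (pow_ne_zero 2 ha') hw),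
    Complex.cpow_def_of_ne_zero hw, ← Complex.ofReal_pow, Complex.log_ofReal_mul (by positivity) hw,
    Real.log_pow, add_mul, Complex.exp_add]
  congr 1
  rw [show (((2 : ℕ) * Real.log a : ℝ) : ℂ) * (1 / 2) = ((Real.log a : ℝ) : ℂ) by push_cast; ring,
    ← Complex.ofReal_exp, Real.exp_log ha]

lemma abs_cos_smul_ellipticIntegrand {k : ℂ} (hk : (k ^ 2).re < 1) {x : ℝ}
    (hx : x ∈ Set.Ioo 0 (Real.pi / 2)) :
    |Real.cos x| • ellipticIntegrand k (Real.sin x) = momentIntegrand 0 (k ^ 2) x := by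
  have hc : 0 < Real.cos x := Real.cos_pos_of_mem_Ioo ⟨by linarith [hx.1, Real.pi_pos], hx.2⟩
  have hc' : (Real.cos x : ℂ) ≠ 0 := by exact_mod_cast hc.ne'
  have hsq : 1 - (Real.sin x : ℂ) ^ 2 = (Real.cos x : ℂ) ^ 2 := by
    exact_mod_cast (Real.cos_sq' x).symm
  have hne := Complex.slitPlane_ne_zero (one_sub_mul_sin_sq_mem_slitPlane hk x)
  rw [ellipticIntegrand, momentIntegrand, hsq, ofReal_sq_mul_cpow_half hc hne, abs_of_pos hc,
    Complex.real_smul, Complex.cpow_neg]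
  field_simp
  simp

lemma intervalIntegrable_ellipticIntegrand {k : ℂ} (hk : (k ^ 2).re < 1) :
    IntervalIntegrable (ellipticIntegrand k) volume 0 1 := by
  rw [intervalIntegrable_iff_integrableOn_Ioo_of_le zero_le_one, ← sin_image_Ioo,
    integrableOn_image_iff_integrableOn_abs_deriv_smul measurableSet_Ioo
      (fun x _ => (Real.hasDerivAt_sin x).hasDerivWithinAt)
      injOn_sin_Ioo,
    integrableOn_congr_fun (fun x hx => abs_cos_smul_ellipticIntegrand hk hx) measurableSet_Ioo]
  exact ((continuous_momentIntegrand 0 hk).continuousOn.integrableOn_Icc).mono_set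
    Set.Ioo_subset_Icc_self

lemma K_eq_ellipticMoment {k : ℂ} (hk : (k ^ 2).re < 1) : K k = ellipticMoment 0 (k ^ 2) := by
  rw [K, ellipticMoment, intervalIntegral.integral_of_le zero_le_one,
    intervalIntegral.integral_of_le (by positivity), integral_Ioc_eq_integral_Ioo,
    integral_Ioc_eq_integral_Ioo, ← sin_image_Ioo,
    integral_image_eq_integral_abs_deriv_smul measurableSet_Ioo
      (fun x _ => (Real.hasDerivAt_sin x).hasDerivWithinAt)
      injOn_sin_Ioo]
  exact setIntegral_congr_fun measurableSet_Ioo fun x hx => abs_cos_smul_ellipticIntegrand hk hx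

/-! ### Wallis integrals and asymptotics of the moments. -/

/-- The Wallis integrals `∫_0^{π/2} sin^{2n} x dx`. -/
def wallisIntegral (n : ℕ) : ℝ := ∫ x in (0 : ℝ)..(Real.pi / 2), (Real.sin x ^ 2) ^ n

lemma ellipticMoment_at_zero (n : ℕ) : ellipticMoment n 0 = wallisIntegral n := by
  rw [ellipticMoment, wallisIntegral, ← intervalIntegral.integral_ofReal]
  refine intervalIntegral.integral_congr fun x _ => ?_
  simp [momentIntegrand, pow_mul]

lemma wallisIntegral_zero : wallisIntegral 0 = Real.pi / 2 := by simp [wallisIntegral]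

lemma wallisIntegral_succ (n : ℕ) :
    (2 * (n : ℝ) + 2) * wallisIntegral (n + 1) = (2 * (n : ℝ) + 1) * wallisIntegral n := by
  -- At z = 0 the term with index n + 2 drops out.
  have h := ellipticMoment_rec n (z := 0) (by simp)
  simp only [ellipticMoment_at_zero] at h
  have h' : ((2 * (n : ℂ) + 2) * wallisIntegral (n + 1) : ℂ) =
    (2 * (n : ℂ) + 1) * wallisIntegral n := by linear_combination -h
  exact_mod_cast h'

lemma wallisIntegral_pos (n : ℕ) : 0 < wallisIntegral n := by
  induction n with
  | zero => rw [wallisIntegral_zero]; positivity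
  | succ n ih =>
    have h := wallisIntegral_succ n
    have : 0 < (2 * (n : ℝ) + 2) * wallisIntegral (n + 1) := by rw [h]; positivity
    exact pos_of_mul_pos_right this (by positivity)

lemma wallisIntegral_sq_mul_W (n : ℕ) :
    (2 * (n : ℝ) + 1) * wallisIntegral n ^ 2 * Real.Wallis.W n = (Real.pi / 2) ^ 2 := by
  induction n with
  | zero => simp [wallisIntegral_zero, Real.Wallis.W]
  | succ n ih =>
    have h : wallisIntegral (n + 1) = (2 * (n : ℝ) + 1) * wallisIntegral n / (2 * n + 2) := by
      rw [← wallisIntegral_succ]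
      field_simp
    rw [← ih, h, Real.Wallis.W_succ]
    push_cast
    have : 2 * ((n : ℝ) + 1) + 1 = 2 * n + 3 := by ring
    rw [this]
    field_simp

lemma tendsto_wallisIntegral_mul_succ :
    Tendsto (fun n : ℕ => (2 * (n : ℝ) + 1) * (wallisIntegral (n + 1) * wallisIntegral n)) atTop
      (𝓝 (Real.pi / 2)) := by
  have h1 : Tendsto (fun n : ℕ => (Real.pi / 2) ^ 2 / Real.Wallis.W n *
      (1 - 1 / (2 * ((n : ℝ) + 1)))) atTop (𝓝 ((Real.pi / 2) ^ 2 / (Real.pi / 2) * (1 - 0))) := by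
    refine (tendsto_const_nhds.div Real.Wallis.tendsto_W_nhds_pi_div_two (by positivity)).mul
      (tendsto_const_nhds.sub ?_)
    have h := (tendsto_one_div_add_atTop_nhds_zero_nat (𝕜 := ℝ)).const_mul (1 / 2)
    rw [mul_zero] at h
    refine h.congr fun n => ?_
    field_simp
  have e : (Real.pi / 2) ^ 2 / (Real.pi / 2) * (1 - 0) = Real.pi / 2 := by
    have := Real.pi_pos
    field_simp
    ring
  rw [e] at h1
  refine h1.congr fun n => ?_
  have hW := (Real.Wallis.W_pos n).ne'
  have h : wallisIntegral (n + 1) = (2 * (n : ℝ) + 1) * wallisIntegral n / (2 * n + 2) := by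
    rw [← wallisIntegral_succ]
    field_simp
  rw [← wallisIntegral_sq_mul_W n, h]
  field_simp
  ring

/-- The normalised powers of sin² concentrate at π/2, their unique maximum, where the remaining
factor is (1-z)^{-1/2}. -/
lemma tendsto_ellipticMoment_div {z : ℂ} (hz : z.re < 1) :
    Tendsto (fun n : ℕ => ellipticMoment n z / wallisIntegral n) atTop
      (𝓝 ((1 - z) ^ (-(1 / 2) : ℂ))) := by
  have hpi : (0 : ℝ) < Real.pi / 2 := by positivity
  have hg : ContinuousOn (momentIntegrand 0 z) (Set.Icc 0 (Real.pi / 2)) :=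
    (continuous_momentIntegrand 0 hz).continuousOn
  have h := tendsto_setIntegral_pow_smul_of_unique_maximum_of_isCompact_of_continuousOn
    (μ := volume) (x₀ := Real.pi / 2) (s := Set.Icc 0 (Real.pi / 2)) isCompact_Icc
    (c := fun x => Real.sin x ^ 2) (by fun_prop) (fun y hy hne => ?_) (fun x _ => sq_nonneg _)
    (by simp) (by rw [interior_Icc, closure_Ioo hpi.ne]; exact ⟨hpi.le, le_rfl⟩) hg
  · have e0 : momentIntegrand 0 z (Real.pi / 2) = (1 - z) ^ (-(1 / 2) : ℂ) := by
      simp [momentIntegrand]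
    rw [e0] at h
    refine h.congr fun n => ?_
    have e : ∫ x in Set.Ioc 0 (Real.pi / 2), (Real.sin x ^ 2) ^ n • momentIntegrand 0 z x =
        ∫ x in Set.Ioc 0 (Real.pi / 2), momentIntegrand n z x :=
      setIntegral_congr_fun measurableSet_Ioc fun x _ => by simp [momentIntegrand, pow_mul]
    rw [ellipticMoment, wallisIntegral, intervalIntegral.integral_of_le hpi.le,
      intervalIntegral.integral_of_le hpi.le, integral_Icc_eq_integral_Ioc,
      integral_Icc_eq_integral_Ioc, e, Complex.real_smul, Complex.ofReal_inv]
    exact inv_mul_eq_div _ _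
  · have hlt : y < Real.pi / 2 := lt_of_le_of_ne hy.2 hne
    have h1 : Real.sin y < Real.sin (Real.pi / 2) :=
      Real.sin_lt_sin_of_lt_of_le_pi_div_two (by linarith [hy.1]) le_rfl hlt
    have h0 : 0 ≤ Real.sin y := Real.sin_nonneg_of_nonneg_of_le_pi hy.1 (by linarith)
    rw [Real.sin_pi_div_two] at h1
    simp only [Real.sin_pi_div_two]
    nlinarith

/-! ### Casoratian, Legendre relation and Hermite polynomials on the unit circle. -/

lemma conj_ellipticMoment_rec (n : ℕ) {z : ℂ} (hz : z.re < 1) (hz' : z * conj z = 1) :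
    (2 * (n : ℂ) + 3) * conj (ellipticMoment (n + 2) z) =
      (2 * (n : ℂ) + 2) * (1 + z) * conj (ellipticMoment (n + 1) z)
        - (2 * (n : ℂ) + 1) * z * conj (ellipticMoment n z) := by
  have h := congrArg conj (ellipticMoment_rec n hz)
  simp only [map_mul, map_sub, map_add, map_natCast, map_one, map_ofNat] at h
  linear_combination z * h + ((2 * (n : ℂ) + 2) * conj (ellipticMoment (n + 1) z) -
    (2 * (n : ℂ) + 3) * conj (ellipticMoment (n + 2) z)) * hz'

/-- The Casoratian of the moments and their conjugates does not depend on `n`. -/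
lemma casoratian_ellipticMoment (n : ℕ) {z : ℂ} (hz : z.re < 1) (hz' : z * conj z = 1) :
    (2 * (n : ℂ) + 1) * (z * ellipticMoment (n + 1) z * conj (ellipticMoment n z) -
      ellipticMoment n z * conj (ellipticMoment (n + 1) z)) =
    z * ellipticMoment 1 z * conj (ellipticMoment 0 z) -
      ellipticMoment 0 z * conj (ellipticMoment 1 z) := by
  induction n with
  | zero => simp
  | succ n ih =>
    rw [← ih]
    push_cast
    linear_combination conj (ellipticMoment (n + 1) z) * ellipticMoment_rec n hz -
      ellipticMoment (n + 1) z * conj_ellipticMoment_rec n hz hz'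

/-- The Legendre relation on the unit circle. -/
lemma legendre_relation {z : ℂ} (hz : z.re < 1) (hz' : z * conj z = 1) :
    z * ellipticMoment 1 z * conj (ellipticMoment 0 z) -
      ellipticMoment 0 z * conj (ellipticMoment 1 z) =
    (Real.pi / 2 : ℝ) * ((z - 1) / (‖1 - z‖ : ℝ)) := by
  have hne : 1 - z ≠ 0 := by
    intro h
    rw [← sub_eq_zero.1 h] at hz
    simp at hz
  set u : ℂ := (1 - z) ^ (-(1 / 2) : ℂ) with hu
  have huu : u * conj u = ((‖1 - z‖⁻¹ : ℝ) : ℂ) := by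
    rw [Complex.mul_conj, Complex.normSq_eq_norm_sq, hu,
      show (-(1 / 2) : ℂ) = ((-(1 / 2) : ℝ) : ℂ) by push_cast; ring, Complex.norm_cpow_real,
      ← Real.rpow_natCast, ← Real.rpow_mul (norm_nonneg _)]
    norm_num [Real.rpow_neg_one]
  have h0 := tendsto_ellipticMoment_div hz
  have h1 := h0.comp (tendsto_add_atTop_nat 1)
  have hc := (Complex.continuous_conj.tendsto u)
  have hw := (Complex.continuous_ofReal.tendsto _).comp tendsto_wallisIntegral_mul_succ
  have hlim := hw.mul (((h1.const_mul z).mul (hc.comp h0)).sub (h0.mul (hc.comp h1)))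
  have e : z * u * conj u - u * conj u = (z - 1) / (‖1 - z‖ : ℝ) := by
    rw [div_eq_mul_inv, ← Complex.ofReal_inv, ← huu]
    ring
  rw [← hu, e] at hlim
  -- The Casoratian is constant in n, so it equals its limit.
  refine tendsto_nhds_unique (tendsto_const_nhds.congr fun n => ?_) hlim
  have hw0 : (wallisIntegral n : ℂ) ≠ 0 := by exact_mod_cast (wallisIntegral_pos n).ne'
  have hw1 : (wallisIntegral (n + 1) : ℂ) ≠ 0 := by exact_mod_cast (wallisIntegral_pos _).ne'
  rw [← casoratian_ellipticMoment n hz hz']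
  simp only [Function.comp_apply, map_div₀, Complex.conj_ofReal]
  push_cast
  field_simp

/-- The Hermite polynomials are the Padé denominators of `z J_1 / J_0`, at the origin and at
infinity. -/
lemma A_eval_mul_casoratian (n : ℕ) {z : ℂ} (hz : z.re < 1) (hz' : z * conj z = 1) :
    (A n).eval z * (z * ellipticMoment 1 z * conj (ellipticMoment 0 z) -
      ellipticMoment 0 z * conj (ellipticMoment 1 z)) =
    z ^ (n + 1) * ellipticMoment (n + 1) z * conj (ellipticMoment 0 z) -
      ellipticMoment 0 z * conj (ellipticMoment (n + 1) z) := by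
  induction n using Nat.twoStepInduction with
  | zero => simp [A_zero]
  | one =>
    have h := ellipticMoment_rec 0 hz
    have h' := conj_ellipticMoment_rec 0 hz hz'
    simp only [Nat.cast_zero, zero_add, mul_zero] at h h'
    simp only [A_one, eval_mul, eval_C, eval_add, eval_one, eval_X, Nat.reduceAdd]
    linear_combination -(1 / 3) * z * conj (ellipticMoment 0 z) * h +
      (1 / 3) * ellipticMoment 0 z * h'
  | more n h0 h1 =>
    have h5 := two_mul_natCast_add_ne_zero n 5 (by norm_num)
    push_cast at h5
    have h := ellipticMoment_rec (n + 1) hz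
    have h' := conj_ellipticMoment_rec (n + 1) hz hz'
    push_cast at h h'
    refine mul_left_cancel₀ h5 ?_
    have eA : (2 * (n : ℂ) + 5) * (A (n + 2)).eval z =
        2 * ((n : ℂ) + 2) * (1 + z) * (A (n + 1)).eval z - (2 * (n : ℂ) + 3) * z * (A n).eval z := by
      rw [A_add_two]
      simp only [eval_mul, eval_C, eval_sub, eval_add, eval_one, eval_X]
      field_simp
    rw [← mul_assoc, eA]
    linear_combination 2 * ((n : ℂ) + 2) * (1 + z) * h1 - (2 * (n : ℂ) + 3) * z * h0
      - z ^ (n + 2) * conj (ellipticMoment 0 z) * h + ellipticMoment 0 z * h'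

/-! ### Mean values over the unit circle. -/

/-- The point `e^{iθ}` of the unit circle. -/
def circlePt (θ : ℝ) : ℂ := Complex.exp (Complex.I * θ)

lemma norm_circlePt (θ : ℝ) : ‖circlePt θ‖ = 1 := by
  rw [circlePt, mul_comm, Complex.norm_exp_ofReal_mul_I]

lemma circlePt_mul_conj (θ : ℝ) : circlePt θ * conj (circlePt θ) = 1 := by
  rw [Complex.mul_conj, Complex.normSq_eq_norm_sq, norm_circlePt]
  simp

lemma conj_circlePt (θ : ℝ) : conj (circlePt θ) = Complex.exp (-(Complex.I * θ)) := by
  rw [circlePt, ← Complex.exp_conj]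
  simp

@[fun_prop]
lemma continuous_circlePt : Continuous circlePt := by
  unfold circlePt
  fun_prop

lemma circlePt_re (θ : ℝ) : (circlePt θ).re = Real.cos θ := by
  rw [circlePt, mul_comm, Complex.exp_ofReal_mul_I_re]

lemma cos_eq_one_sub (θ : ℝ) : Real.cos θ = 1 - 2 * Real.sin (θ / 2) ^ 2 := by
  have h := Real.cos_two_mul (θ / 2)
  rw [mul_div_cancel₀ θ two_ne_zero, Real.cos_sq'] at h
  linarith

lemma sin_half_pos {θ : ℝ} (hθ : θ ∈ Set.Ioo 0 (2 * Real.pi)) : 0 < Real.sin (θ / 2) :=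
  Real.sin_pos_of_pos_of_lt_pi (by linarith [hθ.1]) (by linarith [hθ.2])

lemma circlePt_re_lt_one {θ : ℝ} (hθ : θ ∈ Set.Ioo 0 (2 * Real.pi)) : (circlePt θ).re < 1 := by
  rw [circlePt_re, cos_eq_one_sub]
  have := sin_half_pos hθ
  nlinarith

lemma norm_one_sub_circlePt {θ : ℝ} (hθ : θ ∈ Set.Ioo 0 (2 * Real.pi)) :
    ‖1 - circlePt θ‖ = 2 * Real.sin (θ / 2) := by
  have h := sin_half_pos hθ
  rw [← sq_eq_sq₀ (norm_nonneg _) (by positivity), ← Complex.normSq_eq_norm_sq,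
    Complex.normSq_apply, Complex.sub_re, Complex.sub_im, circlePt_re]
  have him : (circlePt θ).im = Real.sin θ := by
    rw [circlePt, mul_comm, Complex.exp_ofReal_mul_I_im]
  rw [him, Complex.one_re, Complex.one_im]
  nlinarith [Real.sin_sq_add_cos_sq θ, cos_eq_one_sub θ]

lemma exp_half_sq (θ : ℝ) : Complex.exp (Complex.I * (θ / 2)) ^ 2 = circlePt θ := by
  rw [circlePt, ← Complex.exp_nat_mul]
  congr 1
  push_cast
  ring

/-- The mean value property on the unit circle of a function which is holomorphic on the half plane
`Re z < 1` and bounded on the unit disc, but may be singular at `1`. -/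
lemma integral_circlePt_of_bounded {f : ℂ → ℂ} {C : ℝ}
    (hf : DifferentiableOn ℂ f {z : ℂ | z.re < 1})
    (hC : ∀ z : ℂ, ‖z‖ ≤ 1 → z.re < 1 → ‖f z‖ ≤ C) :
    IntervalIntegrable (fun θ => f (circlePt θ)) volume 0 (2 * Real.pi) ∧
      ∫ θ in (0 : ℝ)..(2 * Real.pi), f (circlePt θ) = 2 * Real.pi * f 0 := by
  have h2pi : (0 : ℝ) ≤ 2 * Real.pi := by positivity
  have hIoo (θ : ℝ) (hθ : θ ∈ Set.Ioo 0 (2 * Real.pi)) : (circlePt θ).re < 1 :=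
    circlePt_re_lt_one hθ
  have hre {r : ℝ} (hr : r ∈ Set.Ioo (0 : ℝ) 1) (θ : ℝ) : ((r : ℂ) * circlePt θ).re < 1 := by
    refine (Complex.re_le_norm _).trans_lt ?_
    rw [norm_mul, norm_circlePt, mul_one, Complex.norm_real, Real.norm_of_nonneg hr.1.le]
    exact hr.2
  have hnorm {r : ℝ} (hr : r ∈ Set.Ioo (0 : ℝ) 1) (θ : ℝ) : ‖(r : ℂ) * circlePt θ‖ ≤ 1 := by
    rw [norm_mul, norm_circlePt, mul_one, Complex.norm_real, Real.norm_of_nonneg hr.1.le]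
    exact hr.2.le
  have hr_ev : ∀ᶠ r in 𝓝[<] (1 : ℝ), r ∈ Set.Ioo (0 : ℝ) 1 := Ioo_mem_nhdsLT zero_lt_one
  constructor
  · rw [intervalIntegrable_iff_integrableOn_Ioo_of_le h2pi]
    refine Integrable.of_bound ?_ C ?_
    · exact ((hf.continuousOn.comp continuous_circlePt.continuousOn
        hIoo).aestronglyMeasurable measurableSet_Ioo)
    · exact (ae_restrict_mem measurableSet_Ioo).mono
        fun θ hθ => hC _ (norm_circlePt θ).le (hIoo θ hθ)
  -- The mean value property holds on circles of radius r < 1; r → 1 is then handled by dominated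
  -- convergence with the constant bound.
  · have hmean : ∀ r ∈ Set.Ioo (0 : ℝ) 1,
        ∫ θ in (0 : ℝ)..(2 * Real.pi), f (r * circlePt θ) = 2 * Real.pi * f 0 := by
      intro r hr
      have hd : DiffContOnCl ℂ f (Metric.ball 0 |r|) := by
        refine DifferentiableOn.diffContOnCl (hf.mono ?_)
        refine Metric.closure_ball_subset_closedBall.trans fun z hz => ?_
        rw [mem_closedBall_zero_iff, abs_of_pos hr.1] at hz
        exact ((Complex.re_le_norm z).trans hz).trans_lt hr.2
      have h := hd.circleAverage
      rw [Real.circleAverage_def] at h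
      have e (θ : ℝ) : circleMap 0 r θ = r * circlePt θ := by
        rw [circleMap_zero, circlePt, mul_comm Complex.I]
      simp only [e, Complex.real_smul] at h
      rw [← h]
      have := Real.pi_ne_zero
      push_cast
      field_simp
    have hlim := intervalIntegral.tendsto_integral_filter_of_dominated_convergence (μ := volume)
      (a := 0) (b := 2 * Real.pi) (l := 𝓝[<] (1 : ℝ)) (F := fun r θ => f (r * circlePt θ))
      (f := fun θ => f (circlePt θ)) (fun _ => C) ?_ ?_ intervalIntegrable_const ?_
    · refine tendsto_nhds_unique hlim (tendsto_const_nhds.congr' ?_)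
      filter_upwards [hr_ev] with r hr using (hmean r hr).symm
    · filter_upwards [hr_ev] with r hr
      exact (hf.continuousOn.comp_continuous (by fun_prop) (hre hr)).aestronglyMeasurable
    · filter_upwards [hr_ev] with r hr
      exact ae_of_all _ fun θ _ => hC _ (hnorm hr θ) (hre hr θ)
    -- At θ = 2π the circle meets the possible singularity z = 1.
    · have hne : ∀ᵐ θ : ℝ, θ ≠ 2 * Real.pi := by simp [ae_iff]
      filter_upwards [hne] with θ hθ hθ'
      rw [Set.uIoc_of_le h2pi] at hθ'
      have hθ1 := hIoo θ ⟨hθ'.1, lt_of_le_of_ne hθ'.2 hθ⟩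
      have hcont : ContinuousAt f (circlePt θ) :=
        (hf.differentiableAt (isOpen_re_lt_one.mem_nhds hθ1)).continuousAt
      have h1 : Tendsto (fun r : ℝ => (r : ℂ) * circlePt θ) (𝓝[<] 1) (𝓝 (circlePt θ)) := by
        have : Continuous fun r : ℝ => (r : ℂ) * circlePt θ := by fun_prop
        simpa using (this.tendsto 1).mono_left nhdsWithin_le_nhds
      exact hcont.tendsto.comp h1

/-- The quotients `J_n / J_0` of elliptic moments. -/
def momentRatio (n : ℕ) (z : ℂ) : ℂ := ellipticMoment n z / ellipticMoment 0 z

lemma integral_pow_mul_momentRatio (j n : ℕ) :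
    IntervalIntegrable (fun θ => circlePt θ ^ j * momentRatio n (circlePt θ)) volume
        0 (2 * Real.pi) ∧
      ∫ θ in (0 : ℝ)..(2 * Real.pi), circlePt θ ^ j * momentRatio n (circlePt θ) =
        if j = 0 then 2 * Real.pi * momentRatio n 0 else 0 := by
  have h := integral_circlePt_of_bounded (f := fun z => z ^ j * momentRatio n z) (C := 2) ?_ ?_
  · refine ⟨h.1, h.2.trans ?_⟩
    rcases eq_or_ne j 0 with rfl | hj <;> simp [*]
  · exact (by fun_prop : DifferentiableOn ℂ (fun z : ℂ => z ^ j) _).mul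
      ((differentiableOn_ellipticMoment n).div (differentiableOn_ellipticMoment 0)
        fun z hz => ellipticMoment_zero_ne_zero hz)
  · intro z hz hz1
    have h0 : 0 < ‖ellipticMoment 0 z‖ := norm_pos_iff.2 (ellipticMoment_zero_ne_zero hz1)
    rw [norm_mul, norm_pow, momentRatio, norm_div]
    calc ‖z‖ ^ j * (‖ellipticMoment n z‖ / ‖ellipticMoment 0 z‖) ≤ 1 * 2 := by
          refine mul_le_mul (pow_le_one₀ (norm_nonneg _) hz) ?_ (by positivity) zero_le_one
          rw [div_le_iff₀ h0]
          exact norm_ellipticMoment_le n hz1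
      _ = 2 := one_mul 2

lemma intervalIntegral_conj (f : ℝ → ℂ) (a b : ℝ) :
    ∫ x in a..b, conj (f x) = conj (∫ x in a..b, f x) := by
  simp only [intervalIntegral, integral_conj, map_sub]

lemma intervalIntegrable_conj {f : ℝ → ℂ} {a b : ℝ} (hf : IntervalIntegrable f volume a b) :
    IntervalIntegrable (fun x => conj (f x)) volume a b :=
  ⟨Complex.conjCLE.toContinuousLinearMap.integrable_comp hf.1,
    Complex.conjCLE.toContinuousLinearMap.integrable_comp hf.2⟩

/-- The boundary values `A_n(z) W(z) z^{-j-1}`, where `W` is the weight of the Hermite elliptic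
polynomials. -/
def boundaryMoment (n j : ℕ) (θ : ℝ) : ℂ :=
  circlePt θ ^ (n - j) * momentRatio (n + 1) (circlePt θ) -
    conj (circlePt θ ^ (j + 1) * momentRatio (n + 1) (circlePt θ))

lemma intervalIntegrable_boundaryMoment (n j : ℕ) :
    IntervalIntegrable (boundaryMoment n j) volume 0 (2 * Real.pi) :=
  (integral_pow_mul_momentRatio (n - j) (n + 1)).1.sub
    (intervalIntegrable_conj (integral_pow_mul_momentRatio (j + 1) (n + 1)).1)

lemma integral_boundaryMoment {n j : ℕ} (hj : j ≤ n) :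
    ∫ θ in (0 : ℝ)..(2 * Real.pi), boundaryMoment n j θ =
      if j = n then 2 * Real.pi * momentRatio (n + 1) 0 else 0 := by
  have h1 := integral_pow_mul_momentRatio (n - j) (n + 1)
  have h2 := integral_pow_mul_momentRatio (j + 1) (n + 1)
  simp only [boundaryMoment]
  -- The conjugated part carries the power j + 1 ≥ 1 and integrates to zero; the other part survives
  -- only when n - j = 0.
  rw [intervalIntegral.integral_sub h1.1 (intervalIntegrable_conj h2.1), intervalIntegral_conj,
    h1.2, h2.2, if_neg j.succ_ne_zero, map_zero, sub_zero]
  have : n - j = 0 ↔ j = n := by omega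
  simp only [this]

/-! ### The weight and the orthogonality relations. -/

lemma K_half {θ : ℝ} (hθ : θ ∈ Set.Ioo 0 (2 * Real.pi)) :
    K (Complex.exp (Complex.I * (θ / 2))) = ellipticMoment 0 (circlePt θ) := by
  rw [K_eq_ellipticMoment, exp_half_sq]
  rw [exp_half_sq]
  exact circlePt_re_lt_one hθ

lemma K_half_ne_zero {θ : ℝ} (hθ : θ ∈ Set.Ioo 0 (2 * Real.pi)) :
    K (Complex.exp (Complex.I * (θ / 2))) ≠ 0 := by
  rw [K_half hθ]
  exact ellipticMoment_zero_ne_zero (circlePt_re_lt_one hθ)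

lemma rhoTilde_pos {θ : ℝ} (hθ : θ ∈ Set.Ioo 0 (2 * Real.pi)) : 0 < rhoTilde θ := by
  have h1 := sin_half_pos hθ
  have h2 := norm_pos_iff.2 (K_half_ne_zero hθ)
  unfold rhoTilde
  positivity

/-- `ρ̃ = -(z-1) W(z) / (2πz)` for `z = e^{iθ}`, multiplied by `A_n(z) z^{-j}`. -/
lemma A_eval_mul_rhoTilde {n j : ℕ} (hj : j ≤ n) {θ : ℝ} (hθ : θ ∈ Set.Ioo 0 (2 * Real.pi)) :
    2 * Real.pi * ((A n).eval (circlePt θ) * conj (circlePt θ) ^ j * (rhoTilde θ : ℂ)) =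
      (1 - circlePt θ) * boundaryMoment n j θ := by
  have hre := circlePt_re_lt_one hθ
  have hzz := circlePt_mul_conj θ
  have hA := A_eval_mul_casoratian n hre hzz
  rw [legendre_relation hre hzz, norm_one_sub_circlePt hθ] at hA
  have hs : ((Real.sin (θ / 2) : ℝ) : ℂ) ≠ 0 := by exact_mod_cast (sin_half_pos hθ).ne'
  have h0 := ellipticMoment_zero_ne_zero hre
  have h0c : conj (ellipticMoment 0 (circlePt θ)) ≠ 0 := by simpa using h0
  -- This gives 4 sin²(θ/2) = (1-z)(1-z̄): one sine comes from the weight, the other from the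
  -- Legendre relation.
  have hns : ((‖1 - circlePt θ‖ ^ 2 : ℝ) : ℂ) = (1 - circlePt θ) * (1 - conj (circlePt θ)) := by
    rw [← Complex.normSq_eq_norm_sq, ← Complex.mul_conj, map_sub, map_one]
  rw [norm_one_sub_circlePt hθ] at hns
  have hrho : (rhoTilde θ : ℂ) = (Real.sin (θ / 2) : ℝ) / (2 *
      (ellipticMoment 0 (circlePt θ) * conj (ellipticMoment 0 (circlePt θ)))) := by
    rw [rhoTilde, K_half hθ, Complex.mul_conj, Complex.normSq_eq_norm_sq]
    push_cast
    ring
  have hpow : circlePt θ ^ (n + 1) * conj (circlePt θ) ^ (j + 1) = circlePt θ ^ (n - j) := by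
    obtain ⟨k, rfl⟩ := Nat.exists_eq_add_of_le hj
    rw [show j + k + 1 = k + (j + 1) by ring, pow_add, mul_assoc, ← mul_pow, hzz, one_pow, mul_one]
    congr 1
    omega
  have hB : boundaryMoment n j θ * (ellipticMoment 0 (circlePt θ) *
      conj (ellipticMoment 0 (circlePt θ))) = conj (circlePt θ) ^ (j + 1) *
      ((A n).eval (circlePt θ) * ((Real.pi / 2 : ℝ) *
        ((circlePt θ - 1) / ((2 * Real.sin (θ / 2) : ℝ) : ℂ)))) := by
    rw [hA, boundaryMoment, ← hpow, momentRatio, map_mul, map_pow, map_div₀]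
    field_simp
  generalize conj (ellipticMoment 0 (circlePt θ)) = Jc at *
  generalize ellipticMoment 0 (circlePt θ) = J at *
  generalize conj (circlePt θ) = zc at *
  generalize circlePt θ = z at *
  generalize boundaryMoment n j θ = B at *
  generalize Real.sin (θ / 2) = s at *
  have hJ : J * Jc ≠ 0 := mul_ne_zero h0 h0c
  refine mul_right_cancel₀ hJ ?_
  rw [mul_assoc (1 - z), hB, hrho]
  push_cast at *
  field_simp
  linear_combination eval z (A n) * zc ^ j * hns - eval z (A n) * zc ^ j * (1 - z) * hzz

/-- Cancelling z - 1 leaves only integrable boundary values, whose integrals are known. -/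
lemma tildeP_eval_mul_rhoTilde {n j : ℕ} (hj : j ≤ n) {θ : ℝ}
    (hθ : θ ∈ Set.Ioo 0 (2 * Real.pi)) :
    (tildeP n).eval (circlePt θ) * conj (circlePt θ) ^ j * (rhoTilde θ : ℂ) =
      christoffelRatio P 1 n / (2 * Real.pi * xi n) * boundaryMoment n j θ -
        1 / (2 * Real.pi * xi (n + 1)) * boundaryMoment (n + 1) j θ := by
  have h1 : 1 - circlePt θ ≠ 0 := by
    intro h
    have := circlePt_re_lt_one hθ
    rw [← sub_eq_zero.1 h] at this
    simp at this
  have hpi : (Real.pi : ℂ) ≠ 0 := by exact_mod_cast Real.pi_ne_zero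
  have hx := xi_ne_zero n
  have hx' := xi_ne_zero (n + 1)
  have hT := congrArg (eval (circlePt θ)) (X_sub_one_mul_tildeP n)
  simp only [P, eval_mul, eval_sub, eval_X, eval_C] at hT
  have e0 := A_eval_mul_rhoTilde hj hθ
  have e1 := A_eval_mul_rhoTilde (n := n + 1) (hj.trans n.le_succ) hθ
  refine mul_left_cancel₀ (mul_ne_zero (mul_ne_zero two_ne_zero hpi) h1) ?_
  have hR : 2 * (Real.pi : ℂ) * (1 - circlePt θ) *
      (christoffelRatio P 1 n / (2 * Real.pi * xi n) * boundaryMoment n j θ -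
        1 / (2 * Real.pi * xi (n + 1)) * boundaryMoment (n + 1) j θ) =
      christoffelRatio P 1 n * (1 / xi n) * ((1 - circlePt θ) * boundaryMoment n j θ) -
        1 / xi (n + 1) * ((1 - circlePt θ) * boundaryMoment (n + 1) j θ) := by
    field_simp
  rw [hR, ← e0, ← e1]
  linear_combination -2 * Real.pi * conj (circlePt θ) ^ j * (rhoTilde θ : ℂ) * hT

/-- The squared norms of the polynomials `P̃_n`. -/
def sqNorm (n : ℕ) : ℂ := christoffelRatio P 1 n / xi n * momentRatio (n + 1) 0

lemma integral_congr_Ioo {f g : ℝ → ℂ} {a b : ℝ} (hab : a ≤ b)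
    (h : ∀ θ ∈ Set.Ioo a b, f θ = g θ) : ∫ θ in a..b, f θ = ∫ θ in a..b, g θ := by
  rw [intervalIntegral.integral_of_le hab, intervalIntegral.integral_of_le hab,
    integral_Ioc_eq_integral_Ioo, integral_Ioc_eq_integral_Ioo]
  exact setIntegral_congr_fun measurableSet_Ioo h

lemma intervalIntegrable_congr_Ioo {f g : ℝ → ℂ} {a b : ℝ} (hab : a ≤ b)
    (h : ∀ θ ∈ Set.Ioo a b, f θ = g θ) (hg : IntervalIntegrable g volume a b) :
    IntervalIntegrable f volume a b := by
  rw [intervalIntegrable_iff_integrableOn_Ioo_of_le hab] at hg ⊢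
  exact (integrableOn_congr_fun h measurableSet_Ioo).2 hg

lemma integral_tildeP_mul_conj_pow {n j : ℕ} (hj : j ≤ n) :
    IntervalIntegrable (fun θ => (tildeP n).eval (circlePt θ) * conj (circlePt θ) ^ j *
        (rhoTilde θ : ℂ)) volume 0 (2 * Real.pi) ∧
      ∫ θ in (0 : ℝ)..(2 * Real.pi), (tildeP n).eval (circlePt θ) * conj (circlePt θ) ^ j *
        (rhoTilde θ : ℂ) = if j = n then sqNorm n else 0 := by
  have h2pi : (0 : ℝ) ≤ 2 * Real.pi := by positivity
  have h0 := (intervalIntegrable_boundaryMoment n j).const_mul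
    (christoffelRatio P 1 n / (2 * Real.pi * xi n))
  have h1 := (intervalIntegrable_boundaryMoment (n + 1) j).const_mul
    (1 / (2 * Real.pi * xi (n + 1)))
  have hpi : (Real.pi : ℂ) ≠ 0 := by exact_mod_cast Real.pi_ne_zero
  have hx := xi_ne_zero n
  refine ⟨intervalIntegrable_congr_Ioo h2pi (fun θ hθ => tildeP_eval_mul_rhoTilde hj hθ)
    (h0.sub h1), ?_⟩
  -- Since j ≤ n < n + 1, the second boundary moment never contributes.
  rw [integral_congr_Ioo h2pi fun θ hθ => tildeP_eval_mul_rhoTilde hj hθ,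
    intervalIntegral.integral_sub h0 h1, intervalIntegral.integral_const_mul,
    intervalIntegral.integral_const_mul, integral_boundaryMoment hj,
    integral_boundaryMoment (hj.trans n.le_succ), if_neg (by omega : ¬ j = n + 1), sqNorm]
  split_ifs
  · field_simp
    ring
  · ring

lemma tildeP_zero : tildeP 0 = 1 := (tildeP_monic 0).natDegree_eq_zero.1 (tildeP_natDegree 0)

/-- As P̃_0 = 1, this is the integrability already found for n = j = 0. -/
lemma intervalIntegrable_rhoTilde : IntervalIntegrable rhoTilde volume 0 (2 * Real.pi) := by
  have h := (integral_tildeP_mul_conj_pow (le_refl 0)).1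
  simp only [tildeP_zero, eval_one, pow_zero, one_mul] at h
  exact ⟨h.1.re, h.2.re⟩

lemma integral_tildeP_mul_tildeP_of_le {n m : ℕ} (hm : m ≤ n) :
    ∫ θ in (0 : ℝ)..(2 * Real.pi), (tildeP n).eval (circlePt θ) *
      (tildeP m).eval (conj (circlePt θ)) * (rhoTilde θ : ℂ) = if n = m then sqNorm n else 0 := by
  have e (θ : ℝ) : (tildeP n).eval (circlePt θ) *
      (tildeP m).eval (conj (circlePt θ)) * (rhoTilde θ : ℂ) =
      ∑ j ∈ Finset.range (m + 1), (tildeP m).coeff j *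
        ((tildeP n).eval (circlePt θ) * conj (circlePt θ) ^ j * (rhoTilde θ : ℂ)) := by
    rw [eval_eq_sum_range (p := tildeP m), tildeP_natDegree, Finset.mul_sum, Finset.sum_mul]
    exact Finset.sum_congr rfl fun j _ => by ring
  have hle {j : ℕ} (hj : j ∈ Finset.range (m + 1)) : j ≤ n := by
    rw [Finset.mem_range] at hj
    omega
  simp only [e]
  rw [intervalIntegral.integral_finsetSum fun j hj =>
    (integral_tildeP_mul_conj_pow (hle hj)).1.const_mul _]
  rw [Finset.sum_congr rfl fun j hj => by
    rw [intervalIntegral.integral_const_mul, (integral_tildeP_mul_conj_pow (hle hj)).2]]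
  rcases eq_or_ne n m with rfl | hne
  · have hlead : (tildeP n).coeff n = 1 := by
      have := (tildeP_monic n).coeff_natDegree
      rwa [tildeP_natDegree] at this
    simp [hlead]
  · rw [if_neg hne]
    refine Finset.sum_eq_zero fun j hj => ?_
    rw [Finset.mem_range] at hj
    rw [if_neg (by omega), mul_zero]

lemma conj_eval_tildeP (n : ℕ) (z : ℂ) :
    conj ((tildeP n).eval z) = (tildeP n).eval (conj z) := by
  have h := eval_map_apply (starRingEnd ℂ) (p := tildeP n) z
  rw [tildeP_map_conj] at h
  exact h.symm

lemma momentRatio_succ_zero (n : ℕ) : momentRatio (n + 1) 0 =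
    (2 * (n : ℂ) + 1) / (2 * n + 2) * momentRatio n 0 := by
  have h : (wallisIntegral (n + 1) : ℂ) = (2 * (n : ℂ) + 1) / (2 * n + 2) * wallisIntegral n := by
    have h2 := wallisIntegral_succ n
    have : wallisIntegral (n + 1) = (2 * (n : ℝ) + 1) / (2 * n + 2) * wallisIntegral n := by
      field_simp
      linarith
    rw [this]
    push_cast
    ring
  rw [momentRatio, momentRatio, ellipticMoment_at_zero, ellipticMoment_at_zero,
    ellipticMoment_at_zero, h]
  ring

lemma momentRatio_zero_zero : momentRatio 0 0 = 1 :=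
  div_self (ellipticMoment_zero_ne_zero (by simp))

/-- Consecutive norms have ratio U_{n+1} b_n / U_n, which is 1 - a_n² by
`one_sub_reflectionParam_sq`. -/
lemma sqNorm_eq_prod (n : ℕ) :
    sqNorm n = ∏ j ∈ Finset.range n, (1 - reflectionParam tildeP j ^ 2) := by
  induction n with
  | zero =>
    rw [sqNorm, momentRatio_succ_zero, momentRatio_zero_zero, christoffelRatio_P, xi_zero]
    simp [G]
    norm_num
  | succ n ih =>
    have h3 := two_mul_natCast_add_ne_zero n 3 (by norm_num)
    have h1 := natCast_add_ne_zero n 1 (by norm_num)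
    have h2 := natCast_add_ne_zero n 2 (by norm_num)
    push_cast at h3 h1 h2
    have hx := xi_ne_zero n
    have hU := christoffelRatio_P_ne_zero n
    have h4 : 2 * ((n : ℂ) + 1) + 2 = 2 * (n + 2) := by ring
    rw [Finset.prod_range_succ, ← ih, one_sub_reflectionParam_sq, sqNorm, sqNorm,
      momentRatio_succ_zero (n + 1), xi_succ, recCoeff]
    push_cast
    rw [h4]
    field_simp
    ring

lemma integral_tildeP_mul_tildeP (n m : ℕ) :
    (∫ θ in (0 : ℝ)..(2 * Real.pi),
      (tildeP n).eval (Complex.exp (Complex.I * θ)) *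
        (tildeP m).eval (Complex.exp (-(Complex.I * θ))) * (rhoTilde θ : ℂ)) =
      if n = m then ∏ j ∈ Finset.range n, (1 - reflectionParam tildeP j ^ 2) else 0 := by
  simp only [← conj_circlePt, ← sqNorm_eq_prod]
  change ∫ θ in (0 : ℝ)..(2 * Real.pi), (tildeP n).eval (circlePt θ) *
    (tildeP m).eval (conj (circlePt θ)) * (rhoTilde θ : ℂ) = _
  rcases le_or_gt m n with h | h
  · exact integral_tildeP_mul_tildeP_of_le h
  -- For m > n, conjugation swaps the two polynomials, as their coefficients and the weight are
  -- real.
  · have e := congrArg conj (integral_tildeP_mul_tildeP_of_le h.le)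
    rw [← intervalIntegral_conj, if_neg h.ne', map_zero] at e
    rw [if_neg h.ne, ← e]
    refine intervalIntegral.integral_congr fun θ _ => Eq.symm ?_
    rw [map_mul, map_mul, Complex.conj_ofReal, conj_eval_tildeP, conj_eval_tildeP,
      Complex.conj_conj]
    ring

end HermiteElliptic

end

open HermiteElliptic
theorem mainTheorem5 :
    -- the Christoffel transform at `μ = 1` is defined, and given by an exact division
    (∀ n : ℕ, (P n).eval 1 ≠ 0) ∧
    (∀ n : ℕ, (X - C 1) * tildeP n = P (n + 1) - C ((P (n + 1)).eval 1 / (P n).eval 1) * P n) ∧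
    -- it consists of monic polynomials of degree `n` with real coefficients
    (∀ n : ℕ, (tildeP n).Monic ∧ (tildeP n).natDegree = n ∧
      ∀ j : ℕ, ((tildeP n).coeff j).im = 0) ∧
    -- the Szegő recurrence with the reflection parameters `a_n`
    (∀ n : ℕ, tildeP (n + 1) =
      X * tildeP n - C (reflectionParam tildeP n) * reversedPoly n (tildeP n)) ∧
    -- the reflection parameters
    (∀ n : ℕ, reflectionParam tildeP n =
      ((-1 / (2 * ((n : ℝ) + 2)) - 1 / (2 * ((n : ℝ) + 2) * G (n + 1)) : ℝ) : ℂ)) ∧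
    (∀ n : ℕ, -1 < (reflectionParam tildeP n).re ∧ (reflectionParam tildeP n).re < 0) ∧
    -- the weight is well defined, positive and integrable
    (∀ θ ∈ Set.Ioo (0 : ℝ) (2 * Real.pi),
      IntervalIntegrable (ellipticIntegrand (Complex.exp (Complex.I * (θ / 2))))
        MeasureTheory.volume 0 1 ∧
      K (Complex.exp (Complex.I * (θ / 2))) ≠ 0 ∧ 0 < rhoTilde θ) ∧
    IntervalIntegrable rhoTilde MeasureTheory.volume 0 (2 * Real.pi) ∧
    -- orthogonality on the unit circle
    (∀ n m : ℕ,
      (∫ θ in (0 : ℝ)..(2 * Real.pi),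
        (tildeP n).eval (Complex.exp (Complex.I * θ)) *
          (tildeP m).eval (Complex.exp (-(Complex.I * θ))) * (rhoTilde θ : ℂ)) =
        if n = m then ∏ j ∈ Finset.range n, (1 - reflectionParam tildeP j ^ 2) else 0) := by
  refine ⟨P_eval_one_ne_zero, X_sub_one_mul_tildeP,
    fun n => ⟨tildeP_monic n, tildeP_natDegree n, tildeP_coeff_im n⟩, tildeP_szego,
    reflectionParam_tildeP_eq_ofReal, reflectionParam_tildeP_mem, fun θ hθ => ⟨?_, ?_, ?_⟩,
    intervalIntegrable_rhoTilde, integral_tildeP_mul_tildeP⟩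
  · refine intervalIntegrable_ellipticIntegrand ?_
    rw [exp_half_sq]
    exact circlePt_re_lt_one hθ
  · exact K_half_ne_zero hθ
  · exact rhoTilde_pos hθ
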